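/- Let $X,Y$ be finite sets and let $f$ be a partial or total function from $X\times Y$ to $\{0,1\}$, with the values $0,1$ identified with the signs $+1,-1$. An arrangement of dimension $k$ realizing $f$ consists of points $p_x\in\mathbb{R}^k$ ($x\in X$) and hyperplanes $(h_y,t_y)\in\mathbb{R}^k\times\mathbb{R}$ ($y\in Y$; $h_y=0$ is allowed) such that $\operatorname{sign}(\langle p_x,h_y\rangle-t_y)=f(x,y)$ for every $(x,y)$ at which $f$ is defined. Let $k_f$ be the minimum dimension of an arrangement realizing $f$, let $f^t(y,x)=f(x,y)$, and let $k_f^*=\min(k_f,k_{f^t})$. Let $Q(f)$ be the minimum number of qubits communicated in a two-way quantum protocol between Alice (who knows $x$) and Bob (who knows $y$), without prior entanglement or shared randomness and with any finite number of private workspace qubits, at the end of which one of the two parties obtains by a measurement an output bit that equals $f(x,y)$ with probability greater than $1/2$ for every $(x,y)$ at which $f$ is defined. Let $Q^1(f)$ be the same minimum over one-way protocols, in which only Alice sends qubits and Bob obtains the output. Then all these minima exist, $$\left\lceil \log_2\sqrt{k_f+\tfrac18}-\tfrac12\right\rceil \;\le\; Q(f)\;\le\;\left\lceil\log_2\sqrt{k_f^*+1}\right\rceil,$$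 and $$Q(f)\le Q^1(f)\le Q(f)+1 .$$ -/

import Mathlib

open scoped ComplexOrder

noncomputable section

namespace UnboundedCC

/-! ### Partial Boolean functions and arrangements -/

/-- A partial Boolean function on `X × Y`: `none` means that the value is undefined, so a total
function is one that never takes the value `none`. -/
abbrev PartialFun (X Y : Type*) := X → Y → Option Bool

/-- The function `fᵗ(y, x) = f(x, y)`. -/
def PartialFun.transpose {X Y : Type*} (f : PartialFun X Y) : PartialFun Y X := fun y x => f x y

/-- Points `p x` and hyperplanes `{a | ∑ i, a i * h y i = t y}` in `ℝ^k` realize `f`: the sign of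
`∑ i, p x i * h y i - t y` is `f x y` wherever `f` is defined, with the usual identification of
the Boolean values `0` and `1` with the signs `+1` and `-1`. -/
def Realizes {X Y : Type*} {k : ℕ} (p : X → Fin k → ℝ) (h : Y → Fin k → ℝ) (t : Y → ℝ)
    (f : PartialFun X Y) : Prop :=
  ∀ x y, (f x y = some false → 0 < ∑ i, p x i * h y i - t y) ∧
    (f x y = some true → ∑ i, p x i * h y i - t y < 0)

/-- The dimensions of the arrangements that realize `f`. -/
def arrangementDims {X Y : Type*} (f : PartialFun X Y) : Set ℕ :=
  {k | ∃ (p : X → Fin k → ℝ) (h : Y → Fin k → ℝ) (t : Y → ℝ), Realizes p h t f}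

/-- `k_f`, the minimum dimension of all arrangements that realize `f`. -/
def minDim {X Y : Type*} (f : PartialFun X Y) : ℕ := sInf (arrangementDims f)

/-- `k_f^* = min (k_f, k_{fᵗ})`. -/
def minDimStar {X Y : Type*} (f : PartialFun X Y) : ℕ := min (minDim f) (minDim f.transpose)

/-! ### Two-way quantum communication protocols -/

/-- The computational basis of a register of `n` qubits. -/
abbrev Reg (n : ℕ) := Fin n → Bool

/-- Vectors of the space of `a` qubits held by Alice and `b` qubits held by Bob, given by their
amplitudes in the computational basis. -/
abbrev State (a b : ℕ) := Reg a → Reg b → ℂ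

/-- The initial state `|0…0⟩|0…0⟩`. -/
def State.zero (a b : ℕ) : State a b :=
  fun u v => if u = (fun _ => false) ∧ v = (fun _ => false) then 1 else 0

/-- The operator `U ⊗ I`: an operator on Alice's qubits. -/
def State.applyAlice {a b : ℕ} (U : Matrix (Reg a) (Reg a) ℂ) (ψ : State a b) : State a b :=
  fun u v => U.mulVec (fun u' => ψ u' v) u

/-- The operator `I ⊗ V`: an operator on Bob's qubits. -/
def State.applyBob {a b : ℕ} (V : Matrix (Reg b) (Reg b) ℂ) (ψ : State a b) : State a b :=
  fun u v => V.mulVec (ψ u) v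

/-- The last `m` qubits of Alice pass to Bob, as his first `m` qubits. -/
def State.toBob {a b : ℕ} (m : ℕ) (ψ : State (a + m) b) : State a (m + b) :=
  fun u w => ψ (Fin.append u (fun i => w (Fin.castAdd b i))) (fun j => w (Fin.natAdd m j))

/-- The first `m` qubits of Bob pass to Alice, as her last `m` qubits. -/
def State.toAlice {a b : ℕ} (m : ℕ) (ψ : State a (m + b)) : State (a + m) b :=
  fun w v => ψ (fun i => w (Fin.castAdd m i)) (Fin.append (fun j => w (Fin.natAdd a j)) v)

/-- The inner product `⟨ψ|φ⟩`. -/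
def State.inner {a b : ℕ} (ψ φ : State a b) : ℂ := ∑ u, ∑ v, star (ψ u v) * φ u v

/-- A two-outcome measurement (POVM) on `n` qubits. -/
structure POVM (n : ℕ) where
  /-- the operator that belongs to an outcome -/
  op : Bool → Matrix (Reg n) (Reg n) ℂ
  posSemidef : ∀ c, (op c).PosSemidef
  sum_eq_one : op false + op true = 1

/-- Quantum protocols without prior entanglement, from the moment when Alice holds `a` qubits and
Bob holds `b` qubits. On her turn Alice applies a unitary, which may depend on her input, to her
private part (`a` qubits) and the channel (`m` qubits), and the content of the channel passes to
Bob; likewise for Bob. At the end either Alice or Bob measures what he or she holds and so obtains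
the output bit. The order of the turns and the lengths of the messages do not depend on
the inputs. -/
inductive Protocol (X Y : Type*) : ℕ → ℕ → Type _
  | aliceOutput {a b : ℕ} (M : X → POVM a) : Protocol X Y a b
  | bobOutput {a b : ℕ} (M : Y → POVM b) : Protocol X Y a b
  | aliceSend {a b : ℕ} (m : ℕ) (U : X → Matrix.unitaryGroup (Reg (a + m)) ℂ)
      (next : Protocol X Y a (m + b)) : Protocol X Y (a + m) b
  | bobSend {a b : ℕ} (m : ℕ) (V : Y → Matrix.unitaryGroup (Reg (m + b)) ℂ)
      (next : Protocol X Y (a + m) b) : Protocol X Y a (m + b)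

namespace Protocol

variable {X Y : Type*}

/-- The number of qubits communicated. -/
def cost : {a b : ℕ} → Protocol X Y a b → ℕ
  | _, _, aliceOutput _ => 0
  | _, _, bobOutput _ => 0
  | _, _, aliceSend m _ next => m + next.cost
  | _, _, bobSend m _ next => m + next.cost

/-- The probability that the output is `c` on inputs `x`, `y`, if the protocol is run from the
state `ψ`. -/
def outputProb (x : X) (y : Y) (c : Bool) : {a b : ℕ} → Protocol X Y a b → State a b → ℝ
  | _, _, aliceOutput M, ψ => (ψ.inner (ψ.applyAlice ((M x).op c))).re
  | _, _, bobOutput M, ψ => (ψ.inner (ψ.applyBob ((M y).op c))).re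
  | _, _, aliceSend m U next, ψ => next.outputProb x y c ((ψ.applyAlice (U x).1).toBob m)
  | _, _, bobSend m V next, ψ => next.outputProb x y c ((ψ.applyBob (V y).1).toAlice m)

/-- The protocol, run from `|0…0⟩|0…0⟩`, computes `f` with unbounded error: wherever `f` is
defined, the output is correct with probability greater than `1/2`. -/
def Computes {a b : ℕ} (P : Protocol X Y a b) (f : PartialFun X Y) : Prop :=
  ∀ x y c, f x y = some c → 1 / 2 < P.outputProb x y c (State.zero a b)

/-- One-way protocols: only Alice sends, and Bob obtains the output. -/
def IsOneWay : {a b : ℕ} → Protocol X Y a b → Prop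
  | _, _, aliceOutput _ => False
  | _, _, bobOutput _ => True
  | _, _, aliceSend _ _ next => next.IsOneWay
  | _, _, bobSend _ _ _ => False

end Protocol

/-- The communication costs of the two-way protocols that compute `f` with unbounded error, with
any numbers of workspace qubits. -/
def twoWayCosts {X Y : Type*} (f : PartialFun X Y) : Set ℕ :=
  {n | ∃ (a b : ℕ) (P : Protocol X Y a b), P.Computes f ∧ P.cost = n}

/-- The communication costs of the one-way protocols (Alice to Bob) that compute `f` with
unbounded error. -/
def oneWayCosts {X Y : Type*} (f : PartialFun X Y) : Set ℕ :=
  {n | ∃ (a b : ℕ) (P : Protocol X Y a b), P.IsOneWay ∧ P.Computes f ∧ P.cost = n}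

/-- `Q(f)`, the unbounded-error two-way quantum communication complexity of `f`. -/
def Q {X Y : Type*} (f : PartialFun X Y) : ℕ := sInf (twoWayCosts f)

/-- `Q¹(f)`, the unbounded-error one-way quantum communication complexity of `f`. -/
def Q1 {X Y : Type*} (f : PartialFun X Y) : ℕ := sInf (oneWayCosts f)

end UnboundedCC

end

open scoped ComplexOrder

namespace UnboundedCC

open Matrix

/-! Protocols and arrangements are translated into each other through the Hermitian matrices of
order `2 ^ n`, a real space of dimension `4 ^ n`.

From protocol to arrangement: the initial state is one product term, and each communicated qubit
doubles the number of terms. After `n` qubits the probability of output `0` is therefore a bilinear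
pairing of a Hermitian matrix known to Alice with one known to Bob
(`Protocol.exists_outputProb_eq`). In real coordinates it is an inner product in dimension `4 ^ n`,
to be compared with `1/2`. Hence `k_f ≤ 4 ^ Q(f)`.

From arrangement to protocol: if `k + 1 ≤ 4 ^ n`, the points fit into the traceless Hermitian
matrices. Small multiples of them perturb the maximally mixed state, and the hyperplanes likewise
perturb the measurement `(1/2, 1/2)`; any positive bias suffices
(`Realizes.exists_density_measurement`). The sender prepares a purification and transmits `n` qubits
of it. Alice sends for `f`, Bob for its transpose.

Since `k_f + 1 ≤ 4 ^ Q(f) + 1 ≤ 4 ^ (Q(f) + 1)`, one additional qubit makes any protocol one-way. -/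

/-- Real parts are symmetric and imaginary parts antisymmetric, so the mixed terms cancel in the
sum. This makes the pairing a real inner product with one coordinate per matrix entry. -/
theorem re_sum_mul_of_isHermitian {κ : Type*} [Fintype κ] {A B : Matrix κ κ ℂ}
    (hA : A.IsHermitian) (hB : B.IsHermitian) :
    (∑ i, ∑ j, A i j * B i j).re =
      ∑ i, ∑ j, ((A i j).re + (A i j).im) * ((B i j).re - (B i j).im) := by
  have hAij (i j) : (A j i).re = (A i j).re ∧ (A j i).im = -(A i j).im := by
    rw [← hA.apply i j]; simp
  have hBij (i j) : (B j i).re = (B i j).re ∧ (B j i).im = -(B i j).im := by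
    rw [← hB.apply i j]; simp
  have hskew : ∑ i, ∑ j, ((A i j).im * (B i j).re - (A i j).re * (B i j).im) = 0 := by
    have hswap : ∑ i, ∑ j, ((A i j).im * (B i j).re - (A i j).re * (B i j).im) =
        ∑ i, ∑ j, -((A i j).im * (B i j).re - (A i j).re * (B i j).im) := by
      rw [Finset.sum_comm]
      refine Finset.sum_congr rfl fun i _ => Finset.sum_congr rfl fun j _ => ?_
      rw [(hAij i j).1, (hAij i j).2, (hBij i j).1, (hBij i j).2]
      ring
    simp only [Finset.sum_neg_distrib] at hswap
    linarith
  rw [← sub_eq_zero, ← neg_eq_zero, ← hskew]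
  simp only [Complex.re_sum, Complex.mul_re, ← Finset.sum_sub_distrib, ← Finset.sum_neg_distrib]
  refine Finset.sum_congr rfl fun i _ => Finset.sum_congr rfl fun j _ => ?_
  ring

/-! ### States as sums of product terms -/

/-- The state `∑ i, α i ⊗ β i`. -/
def State.ofFactors {a b : ℕ} {ι : Type*} [Fintype ι] (α : Matrix (Reg a) ι ℂ)
    (β : Matrix (Reg b) ι ℂ) : State a b :=
  fun u v => ∑ i, α u i * β v i

namespace State

variable {a b m : ℕ} {ι : Type*} [Fintype ι]

theorem applyAlice_ofFactors (M : Matrix (Reg a) (Reg a) ℂ) (α : Matrix (Reg a) ι ℂ)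
    (β : Matrix (Reg b) ι ℂ) :
    (ofFactors α β).applyAlice M = ofFactors (M * α) β := by
  ext u v
  simp only [ofFactors, applyAlice, mulVec, dotProduct, mul_apply, Finset.mul_sum, Finset.sum_mul]
  rw [Finset.sum_comm]
  simp only [mul_assoc]

theorem applyBob_ofFactors (M : Matrix (Reg b) (Reg b) ℂ) (α : Matrix (Reg a) ι ℂ)
    (β : Matrix (Reg b) ι ℂ) :
    (ofFactors α β).applyBob M = ofFactors α (M * β) := by
  ext u v
  simp only [ofFactors, applyBob, mulVec, dotProduct, mul_apply, Finset.mul_sum]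
  rw [Finset.sum_comm]
  simp only [mul_left_comm]

/-- Expanding the message in the computational basis splits each term into `2 ^ m` terms; Alice's
factors still depend only on her data, and Bob's only on his. -/
theorem toBob_ofFactors (α : Matrix (Reg (a + m)) ι ℂ) (β : Matrix (Reg b) ι ℂ) :
    (ofFactors α β).toBob m =
      ofFactors (Matrix.of fun u (q : ι × Reg m) => α (Fin.append u q.2) q.1)
        (Matrix.of fun w (q : ι × Reg m) =>
          if (fun i => w (Fin.castAdd b i)) = q.2 then β (fun j => w (Fin.natAdd m j)) q.1 else 0)
      := by
  ext u w
  simp [ofFactors, toBob, Fintype.sum_prod_type]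

theorem toAlice_ofFactors (α : Matrix (Reg a) ι ℂ) (β : Matrix (Reg (m + b)) ι ℂ) :
    (ofFactors α β).toAlice m =
      ofFactors (Matrix.of fun w (q : ι × Reg m) =>
          if (fun j => w (Fin.natAdd a j)) = q.2 then α (fun i => w (Fin.castAdd m i)) q.1 else 0)
        (Matrix.of fun v (q : ι × Reg m) => β (Fin.append q.2 v) q.1)
      := by
  ext w v
  simp [ofFactors, toAlice, Fintype.sum_prod_type]

theorem inner_ofFactors {ι' : Type*} [Fintype ι'] (α : Matrix (Reg a) ι ℂ)
    (β : Matrix (Reg b) ι ℂ) (α' : Matrix (Reg a) ι' ℂ) (β' : Matrix (Reg b) ι' ℂ) :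
    (ofFactors α β).inner (ofFactors α' β') = ∑ i, ∑ j, (αᴴ * α') i j * (βᴴ * β') i j := by
  simp only [ofFactors, inner, mul_apply, conjTranspose_apply, star_sum, star_mul',
    Finset.sum_mul_sum]
  calc _ = ∑ u, ∑ i, ∑ j, ∑ v, star (α u i) * α' u j * (star (β v i) * β' v j) := by
        refine Finset.sum_congr rfl fun u _ => ?_
        rw [Finset.sum_comm]
        refine Finset.sum_congr rfl fun i _ => ?_
        rw [Finset.sum_comm]
        refine Finset.sum_congr rfl fun j _ => Finset.sum_congr rfl fun v _ => ?_
        ring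
    _ = _ := by
        rw [Finset.sum_comm]
        refine Finset.sum_congr rfl fun i _ => ?_
        rw [Finset.sum_comm]

theorem zero_eq_ofFactors :
    State.zero a b = ofFactors (Matrix.of fun u (_ : Unit) => if u = fun _ => false then 1 else 0)
      (Matrix.of fun v _ => if v = fun _ => false then 1 else 0) := by
  ext u v
  by_cases hu : u = fun _ => false <;> simp [State.zero, ofFactors, hu]

end State

/-- A protocol of cost `n` run on a sum of `r` product states has as its output probability the
pairing of two Hermitian matrices of order `r * 2 ^ n`, one for each party. -/
theorem Protocol.exists_outputProb_eq {X Y : Type*} {a b : ℕ} (P : Protocol X Y a b)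
    {ι : Type} [Fintype ι] (α : X → Matrix (Reg a) ι ℂ) (β : Y → Matrix (Reg b) ι ℂ) (c : Bool) :
    ∃ (κ : Type) (_ : Fintype κ) (A : X → Matrix κ κ ℂ) (B : Y → Matrix κ κ ℂ),
      Fintype.card κ = Fintype.card ι * 2 ^ P.cost ∧ (∀ x, (A x).IsHermitian) ∧
      (∀ y, (B y).IsHermitian) ∧
      ∀ x y, P.outputProb x y c (State.ofFactors (α x) (β y)) =
        (∑ i, ∑ j, A x i j * B y i j).re := by
  -- The index type must vary, because each message replaces `ι` by `ι × Reg m`.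
  induction P generalizing ι with
  | aliceOutput M =>
    refine ⟨ι, inferInstance, fun x => (α x)ᴴ * (M x).op c * α x, fun y => (β y)ᴴ * β y,
      by simp [cost], fun x => isHermitian_conjTranspose_mul_mul _ ((M x).posSemidef c).1,
      fun y => isHermitian_conjTranspose_mul_self _, fun x y => ?_⟩
    rw [outputProb, State.applyAlice_ofFactors, State.inner_ofFactors]
    simp only [Matrix.mul_assoc]
  | bobOutput M =>
    refine ⟨ι, inferInstance, fun x => (α x)ᴴ * α x, fun y => (β y)ᴴ * (M y).op c * β y,
      by simp [cost], fun x => isHermitian_conjTranspose_mul_self _,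
      fun y => isHermitian_conjTranspose_mul_mul _ ((M y).posSemidef c).1, fun x y => ?_⟩
    rw [outputProb, State.applyBob_ofFactors, State.inner_ofFactors]
    simp only [Matrix.mul_assoc]
  | aliceSend m U next ih =>
    obtain ⟨κ, _, A, B, hcard, hA, hB, h⟩ := ih (ι := ι × Reg m)
      (fun x => Matrix.of fun u q => ((U x).1 * α x) (Fin.append u q.2) q.1)
      (fun y => Matrix.of fun w q =>
        if (fun i => w (Fin.castAdd _ i)) = q.2 then β y (fun j => w (Fin.natAdd m j)) q.1 else 0)
    refine ⟨κ, ‹_›, A, B, by simp [hcard, cost, pow_add, mul_assoc], hA, hB, fun x y => ?_⟩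
    rw [outputProb, State.applyAlice_ofFactors, State.toBob_ofFactors, h]
  | bobSend m V next ih =>
    obtain ⟨κ, _, A, B, hcard, hA, hB, h⟩ := ih (ι := ι × Reg m)
      (fun x => Matrix.of fun w q =>
        if (fun j => w (Fin.natAdd _ j)) = q.2 then α x (fun i => w (Fin.castAdd m i)) q.1 else 0)
      (fun y => Matrix.of fun v q => ((V y).1 * β y) (Fin.append q.2 v) q.1)
    refine ⟨κ, ‹_›, A, B, by simp [hcard, cost, pow_add, mul_assoc], hA, hB, fun x y => ?_⟩
    rw [outputProb, State.applyBob_ofFactors, State.toAlice_ofFactors, h]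

/-! ### Conservation of total probability -/

namespace State
variable {a b m : ℕ}

theorem inner_applyAlice_self (U : Matrix.unitaryGroup (Reg a) ℂ) (ψ : State a b) :
    (ψ.applyAlice U.1).inner (ψ.applyAlice U.1) = ψ.inner ψ := by
  have h (v : Reg b) : star (U.1 *ᵥ fun u' => ψ u' v) ⬝ᵥ (U.1 *ᵥ fun u' => ψ u' v) =
      star (fun u' => ψ u' v) ⬝ᵥ (fun u' => ψ u' v) := by
    rw [star_mulVec, dotProduct_mulVec, vecMul_vecMul, ← star_eq_conjTranspose,
      UnitaryGroup.star_mul_self, vecMul_one]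
  calc _ = ∑ v, star (U.1 *ᵥ fun u' => ψ u' v) ⬝ᵥ (U.1 *ᵥ fun u' => ψ u' v) := Finset.sum_comm
    _ = ∑ v, star (fun u' => ψ u' v) ⬝ᵥ (fun u' => ψ u' v) := Finset.sum_congr rfl fun v _ => h v
    _ = _ := Finset.sum_comm

theorem inner_applyBob_self (V : Matrix.unitaryGroup (Reg b) ℂ) (ψ : State a b) :
    (ψ.applyBob V.1).inner (ψ.applyBob V.1) = ψ.inner ψ := by
  have h (u : Reg a) : star (V.1 *ᵥ ψ u) ⬝ᵥ (V.1 *ᵥ ψ u) = star (ψ u) ⬝ᵥ (ψ u) := by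
    rw [star_mulVec, dotProduct_mulVec, vecMul_vecMul, ← star_eq_conjTranspose,
      UnitaryGroup.star_mul_self, vecMul_one]
  exact Finset.sum_congr rfl fun u _ => h u

theorem sum_reg_add {m n : ℕ} {M : Type*} [AddCommMonoid M] (F : Reg (m + n) → M) :
    ∑ w, F w = ∑ u : Reg m, ∑ v : Reg n, F (Fin.append u v) := by
  rw [← Fintype.sum_prod_type', ← (Fin.appendEquiv m n).sum_comp]
  rfl

theorem inner_toBob_self (ψ : State (a + m) b) : (ψ.toBob m).inner (ψ.toBob m) = ψ.inner ψ := by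
  simp [inner, toBob, sum_reg_add]

theorem inner_toAlice_self (ψ : State a (m + b)) :
    (ψ.toAlice m).inner (ψ.toAlice m) = ψ.inner ψ := by
  simp [inner, toAlice, sum_reg_add]

theorem inner_zero_self : (State.zero a b).inner (State.zero a b) = 1 := by
  simp [inner, State.zero, ite_and]

end State

/-- Every turn preserves the norm and the measurement operators sum to the identity. From a unit
state, output `1` is thus likely exactly when output `0` has probability below `1/2`, so one
threshold serves both values of `f`. -/
theorem Protocol.outputProb_false_add_true {X Y : Type*} {a b : ℕ} (P : Protocol X Y a b) (x : X)
    (y : Y) (ψ : State a b) :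
    P.outputProb x y false ψ + P.outputProb x y true ψ = (ψ.inner ψ).re := by
  induction P with
  | aliceOutput M =>
    simp only [outputProb, ← Complex.add_re, State.inner, State.applyAlice,
      ← Finset.sum_add_distrib, ← mul_add]
    have h (v) := add_mulVec ((M x).op false) ((M x).op true) (fun u => ψ u v)
    simp only [(M x).sum_eq_one, one_mulVec, funext_iff, Pi.add_apply] at h
    simp only [← h]
  | bobOutput M =>
    simp only [outputProb, ← Complex.add_re, State.inner, State.applyBob,
      ← Finset.sum_add_distrib, ← mul_add]
    have h (u) := add_mulVec ((M y).op false) ((M y).op true) (ψ u)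
    simp only [(M y).sum_eq_one, one_mulVec, funext_iff, Pi.add_apply] at h
    simp only [← h]
  | aliceSend m U next ih =>
    rw [outputProb, outputProb, ih, State.inner_toBob_self, State.inner_applyAlice_self]
  | bobSend m V next ih =>
    rw [outputProb, outputProb, ih, State.inner_toAlice_self, State.inner_applyBob_self]

theorem Protocol.Computes.four_pow_mem_arrangementDims {X Y : Type*} {f : PartialFun X Y}
    {a b : ℕ} {P : Protocol X Y a b} (hP : P.Computes f) : 4 ^ P.cost ∈ arrangementDims f := by
  obtain ⟨κ, _, A, B, hcard, hA, hB, h⟩ := P.exists_outputProb_eq (ι := Unit)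
    (fun _ => Matrix.of fun u _ => if u = fun _ => false then 1 else 0)
    (fun _ => Matrix.of fun v _ => if v = fun _ => false then 1 else 0) false
  have e : Fin (4 ^ P.cost) ≃ κ × κ := Fintype.equivOfCardEq <| by
    simp [hcard, ← mul_pow]
  refine ⟨fun x i => (A x (e i).1 (e i).2).re + (A x (e i).1 (e i).2).im,
    fun y i => (B y (e i).1 (e i).2).re - (B y (e i).1 (e i).2).im, fun _ => 1 / 2, fun x y => ?_⟩
  have hprob : P.outputProb x y false (State.zero a b) =
      ∑ i, ((A x (e i).1 (e i).2).re + (A x (e i).1 (e i).2).im) *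
        ((B y (e i).1 (e i).2).re - (B y (e i).1 (e i).2).im) := by
    rw [State.zero_eq_ofFactors, h, re_sum_mul_of_isHermitian (hA x) (hB y),
      ← Fintype.sum_prod_type', ← e.sum_comp]
  have hsum := P.outputProb_false_add_true x y (State.zero a b)
  rw [State.inner_zero_self, Complex.one_re] at hsum
  rw [← hprob]
  exact ⟨fun hf => sub_pos.2 (hP x y false hf), fun hf => by linarith [hP x y true hf]⟩

/-! ### Density matrices and measurements from an arrangement -/

/-- The Hermitian matrix whose entries have the given sums of real and imaginary parts. -/
noncomputable def hermitianOfReal {κ : Type*} (R : Matrix κ κ ℝ) : Matrix κ κ ℂ :=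
  Matrix.of fun i j => ⟨(R i j + R j i) / 2, (R i j - R j i) / 2⟩

theorem isHermitian_hermitianOfReal {κ : Type*} (R : Matrix κ κ ℝ) :
    (hermitianOfReal R).IsHermitian := by
  ext i j
  apply Complex.ext <;> simp [hermitianOfReal] <;> ring

theorem sum_hermitianOfReal_mul {κ : Type*} [Fintype κ] (R S : Matrix κ κ ℝ) :
    (∑ i, ∑ j, hermitianOfReal R i j * hermitianOfReal Sᵀ i j).re = ∑ i, ∑ j, R i j * S i j := by
  rw [re_sum_mul_of_isHermitian (isHermitian_hermitianOfReal _) (isHermitian_hermitianOfReal _)]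
  refine Finset.sum_congr rfl fun i _ => Finset.sum_congr rfl fun j _ => ?_
  simp only [hermitianOfReal, of_apply, transpose_apply]
  ring

section Norm
open scoped Matrix.Norms.L2Operator MatrixOrder

/-- In the Loewner order, a self-adjoint matrix of norm at most `1` is at least `-1`. -/
theorem posSemidef_one_add_smul {κ : Type*} [Fintype κ] [DecidableEq κ] {H : Matrix κ κ ℂ}
    (hH : H.IsHermitian) {s : ℝ} (hs : |s| * ‖H‖ ≤ 1) : (1 + (s : ℂ) • H).PosSemidef := by
  have hsa : IsSelfAdjoint ((s : ℂ) • H) := by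
    rw [IsSelfAdjoint, star_smul, Complex.star_def, Complex.conj_ofReal]
    exact congrArg _ hH
  have h1 := hsa.neg_algebraMap_norm_le_self
  have hn : ‖(s : ℂ) • H‖ ≤ 1 := by rwa [norm_smul, Complex.norm_real, Real.norm_eq_abs]
  have h2 : algebraMap ℝ (Matrix κ κ ℂ) ‖(s : ℂ) • H‖ ≤ 1 := by
    rw [← map_one (algebraMap ℝ (Matrix κ κ ℂ))]
    exact algebraMap_mono _ hn
  rw [← nonneg_iff_posSemidef]
  calc (0 : Matrix κ κ ℂ) = 1 + -1 := (add_neg_cancel _).symm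
    _ ≤ 1 + (s : ℂ) • H := by gcongr; exact (neg_le_neg h2).trans h1

theorem exists_pos_posSemidef_one_add_smul {Z κ : Type*} [Finite Z] [Fintype κ] [DecidableEq κ]
    {H : Z → Matrix κ κ ℂ} (hH : ∀ z, (H z).IsHermitian) :
    ∃ ε > 0, ∀ z (s : ℝ), |s| ≤ ε → (1 + (s : ℂ) • H z).PosSemidef := by
  obtain ⟨C, hC⟩ := (Set.finite_range fun z => ‖H z‖).bddAbove
  have hC' : 0 < max C 1 := by positivity
  refine ⟨(max C 1)⁻¹, by positivity, fun z s hs => posSemidef_one_add_smul (hH z) ?_⟩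
  calc |s| * ‖H z‖ ≤ (max C 1)⁻¹ * max C 1 := by
        gcongr; exact (hC ⟨z, rfl⟩).trans (le_max_left _ _)
    _ = 1 := inv_mul_cancel₀ hC'.ne'

theorem _root_.Matrix.PosSemidef.exists_conjTranspose_mul_self_eq {κ : Type*} [Fintype κ]
    [DecidableEq κ] {ρ : Matrix κ κ ℂ} (h : ρ.PosSemidef) : ∃ B : Matrix κ κ ℂ, Bᴴ * B = ρ := by
  obtain ⟨B, hB⟩ := CStarAlgebra.nonneg_iff_eq_star_mul_self.1 (nonneg_iff_posSemidef.2 h)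
  exact ⟨B, hB.symm⟩

end Norm

/-- A unit vector extends to an orthonormal basis that has it at position `i₀`. -/
theorem exists_unitary_col_eq {κ : Type*} [Fintype κ] [DecidableEq κ] (i₀ : κ) {ψ : κ → ℂ}
    (h : star ψ ⬝ᵥ ψ = 1) : ∃ U : Matrix.unitaryGroup κ ℂ, ∀ i, U.1 i i₀ = ψ i := by
  have hv : Orthonormal ℂ (({i₀} : Set κ).domRestrict fun _ => WithLp.toLp 2 ψ) := by
    constructor
    · intro i
      have := EuclideanSpace.inner_eq_star_dotProduct (WithLp.toLp 2 ψ) (WithLp.toLp 2 ψ)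
      rw [dotProduct_comm, h] at this
      rw [Set.domRestrict_apply, ← sq_eq_sq₀ (norm_nonneg _) zero_le_one,
        ← inner_self_eq_norm_sq (𝕜 := ℂ), this]
      simp
    · intro i j hij
      exact absurd (Subsingleton.elim i j) hij
  obtain ⟨b, hb⟩ := hv.exists_orthonormalBasis_extension_of_card_eq (by simp)
  refine ⟨⟨_, (EuclideanSpace.basisFun κ ℂ).toMatrix_orthonormalBasis_mem_unitary b⟩, fun i => ?_⟩
  simp [Module.Basis.toMatrix_apply, hb i₀ rfl]

/-- An arrangement in a space of dimension less than the square of the cardinality of `κ` gives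
density matrices and two-outcome measurements on `ℂ^κ` that compute the same function. -/
theorem Realizes.exists_density_measurement {X Y κ : Type*} [Finite X] [Finite Y] [Fintype κ]
    [DecidableEq κ] [Nonempty κ] {k : ℕ} {p : X → Fin k → ℝ} {h : Y → Fin k → ℝ} {t : Y → ℝ}
    {f : PartialFun X Y} (hf : Realizes p h t f) (hk : k + 1 ≤ Fintype.card κ ^ 2) :
    ∃ (ρ : X → Matrix κ κ ℂ) (E : Y → Bool → Matrix κ κ ℂ), (∀ x, (ρ x).PosSemidef) ∧
      (∀ x, (ρ x).trace = 1) ∧ (∀ y c, (E y c).PosSemidef) ∧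
      (∀ y, E y false + E y true = 1) ∧
      ∀ x y c, f x y = some c → 1 / 2 < (∑ i, ∑ j, ρ x i j * E y c i j).re := by
  classical
  obtain ⟨i₀⟩ := ‹Nonempty κ›
  -- The entry `(i₀, i₀)` stays free to correct the trace of `R' x`; `S y` vanishes there, so the
  -- correction does not affect the pairing.
  obtain ⟨e⟩ : Nonempty (Fin k ↪ {q : κ × κ // q ≠ (i₀, i₀)}) := by
    refine Function.Embedding.nonempty_of_card_le ?_
    rw [Fintype.card_fin, Fintype.card_subtype_compl, Fintype.card_prod, ← sq,
      Fintype.card_subtype_eq]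
    omega
  -- the pairing of `R' x` with `S y` is `∑ j, p x j * h y j`, also after making `R' x` traceless
  let R' (x : X) : Matrix κ κ ℝ := Matrix.of fun i j => ∑ l, if (e l).1 = (i, j) then p x l else 0
  let R (x : X) : Matrix κ κ ℝ := R' x - single i₀ i₀ (R' x).trace
  let S (y : Y) : Matrix κ κ ℝ := Matrix.of fun i j => ∑ l, if (e l).1 = (i, j) then h y l else 0
  have hRS (x : X) (y : Y) : ∑ i, ∑ j, R x i j * S y i j = ∑ l, p x l * h y l := by
    have hR (l) : R x (e l).1.1 (e l).1.2 = p x l := by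
      have : ¬(i₀ = (e l).1.1 ∧ i₀ = (e l).1.2) := fun hl => (e l).2 (Prod.ext hl.1.symm hl.2.symm)
      simp [R, R', this, ← Subtype.ext_iff]
    rw [← Fintype.sum_prod_type' (f := fun i j => R x i j * S y i j)]
    simp only [S, of_apply, Finset.mul_sum]
    rw [Finset.sum_comm]
    refine Finset.sum_congr rfl fun l _ => ?_
    simp [← hR l]
  let H (x : X) := hermitianOfReal (R x)
  let G (y : Y) := hermitianOfReal (S y)ᵀ
  have hH (x) : (H x).IsHermitian := isHermitian_hermitianOfReal _
  have hG (y) : (G y).IsHermitian := isHermitian_hermitianOfReal _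
  have hHtr (x) : (H x).trace = 0 := by
    have : (H x).trace = ((R x).trace : ℂ) := by
      simp only [trace, diag_apply, Complex.ofReal_sum]
      refine Finset.sum_congr rfl fun i _ => Complex.ext ?_ ?_ <;> simp [H, hermitianOfReal]
    rw [this]
    simp [R]
  obtain ⟨ε, hε, hHε⟩ := exists_pos_posSemidef_one_add_smul hH
  let d : ℝ := Fintype.card κ
  have hd : 0 < d := Nat.cast_pos.2 (Fintype.card_pos_iff.2 ⟨i₀⟩)
  -- Since `ρ x` has trace `1`, adding `s y` times the identity shifts the pairing by `s y`; this
  -- value cancels the trace of `G y` and puts the threshold at `t y`.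
  let s (y : Y) : ℝ := -((G y).trace.re + ε * t y) / d
  let K (y : Y) : Matrix κ κ ℂ := G y + (s y : ℂ) • 1
  have hK (y) : (K y).IsHermitian := (hG y).add <| by
    rw [IsHermitian, conjTranspose_smul, conjTranspose_one, Complex.star_def, Complex.conj_ofReal]
  obtain ⟨δ, hδ, hKδ⟩ := exists_pos_posSemidef_one_add_smul hK
  let ρ (x : X) : Matrix κ κ ℂ := ((d⁻¹ : ℝ) : ℂ) • (1 + (ε : ℂ) • H x)
  let σ (c : Bool) : ℝ := if c then -δ else δ
  have hρtr (x) : (ρ x).trace = 1 := by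
    simp only [ρ, trace_smul, trace_add, trace_one, hHtr, smul_eq_mul, mul_zero, add_zero]
    rw [Complex.ofReal_inv]
    exact inv_mul_cancel₀ (Complex.ofReal_ne_zero.2 hd.ne')
  have hpair_one (A : Matrix κ κ ℂ) : ∑ i, ∑ j, A i j * (1 : Matrix κ κ ℂ) i j = A.trace := by
    simp [one_apply, trace]
  have hone_pair (A : Matrix κ κ ℂ) : ∑ i, ∑ j, (1 : Matrix κ κ ℂ) i j * A i j = A.trace := by
    simp [one_apply, trace]
  have hpairG (x y) : (∑ i, ∑ j, ρ x i j * G y i j).re =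
      d⁻¹ * ((G y).trace.re + ε * ∑ l, p x l * h y l) := by
    have : ∑ i, ∑ j, ρ x i j * G y i j =
        ((d⁻¹ : ℝ) : ℂ) * ((G y).trace + (ε : ℂ) * ∑ i, ∑ j, H x i j * G y i j) := by
      rw [← hone_pair]
      simp only [ρ, Matrix.smul_apply, Matrix.add_apply, smul_eq_mul, Finset.mul_sum,
        ← Finset.sum_add_distrib]
      refine Finset.sum_congr rfl fun i _ => Finset.sum_congr rfl fun j _ => ?_
      ring
    rw [this, Complex.re_ofReal_mul, Complex.add_re, Complex.re_ofReal_mul,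
      sum_hermitianOfReal_mul, hRS]
  have hpairK (x y) : (∑ i, ∑ j, ρ x i j * K y i j).re =
      d⁻¹ * ε * (∑ l, p x l * h y l - t y) := by
    have : ∑ i, ∑ j, ρ x i j * K y i j =
        ∑ i, ∑ j, ρ x i j * G y i j + (s y : ℂ) * (ρ x).trace := by
      rw [← hpair_one]
      simp only [K, Matrix.smul_apply, Matrix.add_apply, smul_eq_mul, Finset.mul_sum,
        ← Finset.sum_add_distrib]
      refine Finset.sum_congr rfl fun i _ => Finset.sum_congr rfl fun j _ => ?_
      ring
    rw [this, hρtr, mul_one, Complex.add_re, hpairG, Complex.ofReal_re]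
    simp only [s]
    ring
  refine ⟨ρ, fun y c => ((1 / 2 : ℝ) : ℂ) • (1 + (σ c : ℂ) • K y), fun x => ?_, hρtr,
    fun y c => ?_, fun y => ?_, fun x y c hc => ?_⟩
  · exact (hHε x ε (abs_of_pos hε).le).smul (Complex.zero_le_real.2 (inv_nonneg.2 hd.le))
  · refine (hKδ y (σ c) ?_).smul (Complex.zero_le_real.2 (by norm_num))
    cases c <;> simp [σ, abs_of_pos hδ]
  · ext i j
    simp [σ]
    ring
  · have : ∑ i, ∑ j, ρ x i j * (((1 / 2 : ℝ) : ℂ) • (1 + (σ c : ℂ) • K y)) i j =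
        ((1 / 2 : ℝ) : ℂ) * ((ρ x).trace + (σ c : ℂ) * ∑ i, ∑ j, ρ x i j * K y i j) := by
      rw [← hpair_one]
      simp only [Matrix.smul_apply, Matrix.add_apply, smul_eq_mul, Finset.mul_sum,
        ← Finset.sum_add_distrib]
      refine Finset.sum_congr rfl fun i _ => Finset.sum_congr rfl fun j _ => ?_
      ring
    rw [this, hρtr, Complex.re_ofReal_mul, Complex.add_re, Complex.re_ofReal_mul, hpairK,
      Complex.one_re]
    have hdε : 0 < d⁻¹ * ε := by positivity
    suffices 0 < σ c * (d⁻¹ * ε * (∑ l, p x l * h y l - t y)) by linarith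
    cases c
    · simpa [σ] using mul_pos hδ (mul_pos hdε ((hf x y).1 hc))
    · simpa [σ] using mul_neg_of_pos_of_neg hδ (mul_neg_of_pos_of_neg hdε ((hf x y).2 hc))

/-! ### Preparing and sending purifications -/

namespace State

variable {a b : ℕ}

/-- Bob's measurement sees only his reduced state; the entrywise pairing uses its transpose. -/
theorem inner_applyBob_eq (ψ : State a b) (E : Matrix (Reg b) (Reg b) ℂ) :
    ψ.inner (ψ.applyBob E) = ∑ v, ∑ v', ((Matrix.of ψ)ᴴ * Matrix.of ψ) v v' * E v v' := by
  simp only [inner, applyBob, mulVec, dotProduct, mul_apply, conjTranspose_apply, of_apply,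
    Finset.mul_sum, Finset.sum_mul]
  rw [Finset.sum_comm]
  refine Finset.sum_congr rfl fun v _ => ?_
  rw [Finset.sum_comm]
  refine Finset.sum_congr rfl fun v' _ => Finset.sum_congr rfl fun u _ => ?_
  ring

theorem inner_applyAlice_eq (ψ : State a b) (E : Matrix (Reg a) (Reg a) ℂ) :
    ψ.inner (ψ.applyAlice E) =
      ∑ u, ∑ u', ((Matrix.of fun v u => ψ u v)ᴴ * Matrix.of fun v u => ψ u v) u u' * E u u' := by
  simp only [inner, applyAlice, mulVec, dotProduct, mul_apply, conjTranspose_apply, of_apply,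
    Finset.mul_sum, Finset.sum_mul]
  refine Finset.sum_congr rfl fun u _ => ?_
  rw [Finset.sum_comm]
  refine Finset.sum_congr rfl fun u' _ => Finset.sum_congr rfl fun v _ => ?_
  ring

theorem inner_self_eq_trace (ψ : State a b) :
    ψ.inner ψ = ((Matrix.of ψ)ᴴ * Matrix.of ψ).trace := by
  simp only [inner, trace, diag_apply, mul_apply, conjTranspose_apply, of_apply]
  exact Finset.sum_comm

theorem inner_self_eq_trace_swap (ψ : State a b) :
    ψ.inner ψ = ((Matrix.of fun v u => ψ u v)ᴴ * Matrix.of fun v u => ψ u v).trace := by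
  simp only [inner, trace, diag_apply, mul_apply, conjTranspose_apply, of_apply]

theorem exists_applyAlice_zero_eq (ψ : State a 0) (h : ψ.inner ψ = 1) :
    ∃ U : Matrix.unitaryGroup (Reg a) ℂ, (State.zero a 0).applyAlice U.1 = ψ := by
  obtain ⟨U, hU⟩ := exists_unitary_col_eq (fun _ => false) (ψ := fun u => ψ u default) <| by
    rw [← h]
    exact Finset.sum_congr rfl fun u _ =>
      (Fintype.sum_subsingleton (fun v => star (ψ u v) * ψ u v) default).symm
  refine ⟨U, ?_⟩
  ext u v
  rw [Subsingleton.elim v default, ← hU]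
  simp [applyAlice, State.zero, mulVec, dotProduct]

theorem exists_applyBob_zero_eq (ψ : State 0 b) (h : ψ.inner ψ = 1) :
    ∃ V : Matrix.unitaryGroup (Reg b) ℂ, (State.zero 0 b).applyBob V.1 = ψ := by
  obtain ⟨V, hV⟩ := exists_unitary_col_eq (fun _ => false) (ψ := fun v => ψ default v) <| by
    rw [← h]
    exact (Fintype.sum_subsingleton (fun u => ∑ v, star (ψ u v) * ψ u v) default).symm
  refine ⟨V, ?_⟩
  ext u v
  rw [Subsingleton.elim u default, ← hV]
  simp [applyBob, State.zero, mulVec, dotProduct]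

/-- Alice can hand over to Bob half of any pure state of two registers of `n` qubits. -/
theorem exists_toBob_applyAlice_zero_eq {n : ℕ} (B : State n n) (h : B.inner B = 1) :
    ∃ U : Matrix.unitaryGroup (Reg (n + n)) ℂ,
      ((State.zero (n + n) 0).applyAlice U.1).toBob n = B := by
  let Ψ : State (n + n) 0 := fun z _ =>
    B (fun i => z (Fin.castAdd n i)) (fun j => z (Fin.natAdd n j))
  have hΨ : Ψ.toBob n = B := by
    ext u w
    simp only [toBob, Ψ, Fin.append_left, Fin.append_right]
    rfl
  obtain ⟨U, hU⟩ := exists_applyAlice_zero_eq Ψ <| by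
    rw [← inner_toBob_self, hΨ]
    exact h
  exact ⟨U, by rw [hU, hΨ]⟩

/-- Bob can hand over to Alice half of any pure state of two registers of `n` qubits. -/
theorem exists_toAlice_applyBob_zero_eq {n : ℕ} (B : State (0 + n) (0 + n)) (h : B.inner B = 1) :
    ∃ V : Matrix.unitaryGroup (Reg (n + (0 + n))) ℂ,
      ((State.zero 0 (n + (0 + n))).applyBob V.1).toAlice n = B := by
  let Ψ : State 0 (n + (0 + n)) := fun _ z =>
    B (fun i => z (Fin.castAdd _ (Fin.cast (zero_add n) i))) (fun j => z (Fin.natAdd n j))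
  have hΨ : Ψ.toAlice n = B := by
    ext w v
    simp only [toAlice, Ψ, Fin.append_left, Fin.append_right, Fin.natAdd_zero]
    rfl
  obtain ⟨V, hV⟩ := exists_applyBob_zero_eq Ψ <| by
    rw [← inner_toAlice_self, hΨ]
    exact h
  exact ⟨V, by rw [hV, hΨ]⟩

end State

/-! ### Costs, dimensions and logarithms -/

variable {X Y : Type*} {f : PartialFun X Y} {k n : ℕ}

theorem mem_oneWayCosts_of_mem_arrangementDims [Finite X] [Finite Y] (hk : k ∈ arrangementDims f)
    (hn : k + 1 ≤ 4 ^ n) : n ∈ oneWayCosts f := by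
  obtain ⟨p, h, t, hf⟩ := hk
  obtain ⟨ρ, E, hρ, hρtr, hE, hEsum, hρE⟩ := hf.exists_density_measurement (κ := Reg n) <| by
    simpa [← pow_mul, mul_comm n, pow_mul 2 2] using hn
  -- Read as a bipartite state, the factor `B x` is a purification of `ρ x`.
  choose B hB using fun x => (hρ x).exists_conjTranspose_mul_self_eq
  choose U hU using fun x => State.exists_toBob_applyAlice_zero_eq (fun u w => B x u w)
    ((State.inner_self_eq_trace _).trans ((congrArg trace (hB x)).trans (hρtr x)))
  refine ⟨n + n, 0, .aliceSend n U (.bobOutput (b := n) fun y => ⟨E y, hE y, hEsum y⟩), trivial,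
    fun x y c hc => ?_, rfl⟩
  have hprob := hρE x y c hc
  rw [← hB x] at hprob
  refine hprob.trans_eq (Eq.symm ?_)
  exact (congrArg (fun ψ : State n n => (ψ.inner (ψ.applyBob (E y c))).re) (hU x)).trans
    (congrArg Complex.re (State.inner_applyBob_eq _ _))

theorem mem_twoWayCosts_of_mem_arrangementDims_transpose [Finite X] [Finite Y]
    (hk : k ∈ arrangementDims f.transpose) (hn : k + 1 ≤ 4 ^ n) : n ∈ twoWayCosts f := by
  obtain ⟨p, h, t, hf⟩ := hk
  obtain ⟨ρ, E, hρ, hρtr, hE, hEsum, hρE⟩ :=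
    -- Alice starts with no qubits and ends with `0 + n`, which does not reduce to `n`; Bob keeps as
    -- many so that both registers have the same type.
    hf.exists_density_measurement (κ := Reg (0 + n)) <| by
      simpa [← pow_mul, mul_comm n, pow_mul 2 2] using hn
  choose B hB using fun y => (hρ y).exists_conjTranspose_mul_self_eq
  choose V hV using fun y => State.exists_toAlice_applyBob_zero_eq (fun w v => B y v w)
    ((State.inner_self_eq_trace_swap _).trans ((congrArg trace (hB y)).trans (hρtr y)))
  refine ⟨0, n + (0 + n), .bobSend n V (.aliceOutput fun x => ⟨E x, hE x, hEsum x⟩),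
    fun x y c hc => ?_, rfl⟩
  have hprob := hρE y x c hc
  rw [← hB y] at hprob
  refine hprob.trans_eq (Eq.symm ?_)
  exact (congrArg (fun ψ : State (0 + n) (0 + n) => (ψ.inner (ψ.applyAlice (E x c))).re)
    (hV y)).trans (congrArg Complex.re (State.inner_applyAlice_eq _ _))

theorem oneWayCosts_subset_twoWayCosts (f : PartialFun X Y) : oneWayCosts f ⊆ twoWayCosts f := by
  rintro _ ⟨a, b, P, -, hP, rfl⟩
  exact ⟨a, b, P, hP, rfl⟩

theorem arrangementDims_nonempty [Finite X] (f : PartialFun X Y) :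
    (arrangementDims f).Nonempty := by
  obtain ⟨k, ⟨e⟩⟩ := Finite.exists_equiv_fin X
  -- The points are the standard basis vectors, and the coordinates of `h y` are the signs of `f` at
  -- `y`; undefined values may get either sign.
  refine ⟨k, fun x i => if i = e x then 1 else 0,
    fun y i => if f (e.symm i) y = some false then 1 else -1, fun _ => 0, fun x y => ?_⟩
  simp only [ite_mul, one_mul, zero_mul, Finset.sum_ite_eq', Finset.mem_univ,
    if_true, e.symm_apply_apply, sub_zero]
  constructor <;> intro h <;> simp [h]

/-- The claim amounts to `k + 1/8 ≤ 2 * 4 ^ n`. -/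
theorem ceil_logb_sqrt_sub_half_le {k n : ℕ} (h : k ≤ 4 ^ n) :
    ⌈Real.logb 2 (Real.sqrt ((k : ℝ) + 1 / 8)) - 1 / 2⌉ ≤ (n : ℤ) := by
  have h4 : (1 : ℝ) ≤ 4 ^ n := one_le_pow₀ (by norm_num)
  have hk : (k : ℝ) + 1 / 8 ≤ 2 ^ (2 * n + 1) := by
    have : (k : ℝ) ≤ 4 ^ n := by exact_mod_cast h
    rw [pow_succ, pow_mul]
    norm_num
    linarith
  have hlog : Real.logb 2 ((k : ℝ) + 1 / 8) ≤ 2 * n + 1 := by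
    rw [Real.logb_le_iff_le_rpow one_lt_two (by positivity)]
    exact_mod_cast hk
  rw [Int.ceil_le, Real.sqrt_eq_rpow, Real.logb_rpow_eq_mul_logb_of_pos (by positivity)]
  push_cast
  linarith

theorem exists_ceil_logb_sqrt_eq (k : ℕ) :
    ∃ n : ℕ, ⌈Real.logb 2 (Real.sqrt ((k : ℝ) + 1))⌉ = n ∧ k + 1 ≤ 4 ^ n := by
  have h0 : 0 ≤ Real.logb 2 (Real.sqrt ((k : ℝ) + 1)) :=
    Real.logb_nonneg one_lt_two (Real.one_le_sqrt.2 (by simp))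
  obtain ⟨n, hn⟩ := Int.eq_ofNat_of_zero_le (Int.ceil_nonneg h0)
  refine ⟨n, hn, ?_⟩
  have h1 := Int.ceil_le.1 hn.le
  rw [Real.sqrt_eq_rpow, Real.logb_rpow_eq_mul_logb_of_pos (by positivity)] at h1
  have h2 : Real.logb 2 ((k : ℝ) + 1) ≤ (2 * n : ℕ) := by
    push_cast at h1 ⊢
    linarith
  rw [Real.logb_le_iff_le_rpow one_lt_two (by positivity), Real.rpow_natCast, pow_mul] at h2
  norm_num at h2
  exact_mod_cast h2

end UnboundedCC

open UnboundedCC in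
theorem theorem1 {X Y : Type*} [Finite X] [Finite Y] (f : UnboundedCC.PartialFun X Y) :
    -- the minima that define `k_f`, `k_{fᵗ}`, `Q(f)` and `Q¹(f)` are over non-empty sets
    (UnboundedCC.arrangementDims f).Nonempty ∧
    (UnboundedCC.arrangementDims f.transpose).Nonempty ∧
    (UnboundedCC.twoWayCosts f).Nonempty ∧
    (UnboundedCC.oneWayCosts f).Nonempty ∧
    -- the bounds on `Q(f)`
    ⌈Real.logb 2 (Real.sqrt ((UnboundedCC.minDim f : ℝ) + 1 / 8)) - 1 / 2⌉
      ≤ (UnboundedCC.Q f : ℤ) ∧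
    (UnboundedCC.Q f : ℤ)
      ≤ ⌈Real.logb 2 (Real.sqrt ((UnboundedCC.minDimStar f : ℝ) + 1))⌉ ∧
    -- two-way and one-way complexity differ by at most one qubit
    UnboundedCC.Q f ≤ UnboundedCC.Q1 f ∧
    UnboundedCC.Q1 f ≤ UnboundedCC.Q f + 1 := by
  have hA := arrangementDims_nonempty f
  have hAt := arrangementDims_nonempty f.transpose
  have hone : (oneWayCosts f).Nonempty := by
    obtain ⟨n, -, hn⟩ := exists_ceil_logb_sqrt_eq (minDim f)
    exact ⟨n, mem_oneWayCosts_of_mem_arrangementDims (Nat.sInf_mem hA) hn⟩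
  have htwo : (twoWayCosts f).Nonempty := hone.mono (oneWayCosts_subset_twoWayCosts f)
  have hdim : minDim f ≤ 4 ^ Q f := by
    obtain ⟨a, b, P, hP, hcost⟩ := Nat.sInf_mem htwo
    rw [Q, ← hcost]
    exact Nat.sInf_le hP.four_pow_mem_arrangementDims
  refine ⟨hA, hAt, htwo, hone, ceil_logb_sqrt_sub_half_le hdim, ?_,
    Nat.sInf_le (oneWayCosts_subset_twoWayCosts f (Nat.sInf_mem hone)), ?_⟩
  · obtain ⟨n, hceil, hn⟩ := exists_ceil_logb_sqrt_eq (minDimStar f)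
    rw [hceil]
    refine Nat.cast_le.2 (Nat.sInf_le ?_)
    obtain hmin | hmin := min_choice (minDim f) (minDim f.transpose)
    · rw [minDimStar, hmin] at hn
      exact oneWayCosts_subset_twoWayCosts f
        (mem_oneWayCosts_of_mem_arrangementDims (Nat.sInf_mem hA) hn)
    · rw [minDimStar, hmin] at hn
      exact mem_twoWayCosts_of_mem_arrangementDims_transpose (Nat.sInf_mem hAt) hn
  · refine Nat.sInf_le (mem_oneWayCosts_of_mem_arrangementDims (Nat.sInf_mem hA) ?_)
    have : 0 < 4 ^ Q f := by positivity
    rw [pow_succ]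
    exact (Nat.succ_le_succ hdim).trans (by omega)
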